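/- Let $p$ be an odd prime and let $G$ be a group that can be generated by four elements (possibly by fewer), that is nilpotent of class at most $2$, and that satisfies $g^p=1$ for all $g\in G$. Then exactly one of the following holds: (i) $G$ is cyclic and nontrivial; (ii) $G$ is extra-special of order $p^5$ and exponent $p$; (iii) $G$ is capable, that is, there exists a group $K$ such that $G\cong K/Z(K)$. Here a finite $p$-group is called extra-special if its center has order $p$ and its central quotient is a nontrivial elementary abelian $p$-group. -/

import Mathlib

universe u

/-- A group `G` is capable if it is isomorphic to the central quotient `K / Z(K)` of some group `K`.
There is no loss in taking `K` in the universe of `G`: the subgroup of `K` generated by a set of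
coset representatives of `Z(K)` has the same central quotient, and its cardinality is at most
`max |G| ℵ₀`. -/
def IsCapable (G : Type u) [Group G] : Prop :=
  ∃ (K : Type u) (_ : Group K), Nonempty (G ≃* K ⧸ Subgroup.center K)

/-- An extra-special `p`-group: a finite `p`-group whose center has order `p` and whose central
quotient is a nontrivial elementary abelian `p`-group. -/
structure IsExtraSpecial (p : ℕ) (G : Type u) [Group G] : Prop where
  card_eq_pow : ∃ n : ℕ, Nat.card G = p ^ n
  card_center : Nat.card (Subgroup.center G) = p
  nontrivial_quotient : Nontrivial (G ⧸ Subgroup.center G)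
  comm_quotient : ∀ a b : G ⧸ Subgroup.center G, a * b = b * a
  pow_quotient : ∀ a : G ⧸ Subgroup.center G, a ^ p = 1

/-- A group is `k`-generated if it is generated by `k` elements, not necessarily distinct
(so it may need fewer). -/
def IsGeneratedBy (k : ℕ) (G : Type u) [Group G] : Prop :=
  ∃ g : Fin k → G, Subgroup.closure (Set.range g) = ⊤

/-- Exactly one of three propositions holds. -/
def ExactlyOne (P Q R : Prop) : Prop :=
  (P ∧ ¬ Q ∧ ¬ R) ∨ (¬ P ∧ Q ∧ ¬ R) ∨ (¬ P ∧ ¬ Q ∧ R)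

/-! The group `G` is capable as soon as each central `g ≠ 1` has some central extension of `G` in
which no element over `g` is central: the product of these extensions over `G` then has centre
exactly the kernel of its projection.

Obstructions. If `K/Z(K)` is cyclic then `K` is abelian. If `K/Z(K)` is extra-special of order
`p^5`, the image of each `x : K` commutes with two elements that do not commute with each other. So
`x` commutes modulo `Z(K)` with lifts `a`, `b`, hence commutes with `⁅a, b⁆`, whose image generates
`Z(G)`. Every lift of an element of `Z(G)` is therefore central in `K`, which is absurd.

Construction. The Baer correspondence turns `G` into an `𝔽_p`-space `L` with an alternating bracket,
and cocycles are sought as polynomials in linear forms. A central `z` outside the derived space `D`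
is handled by a product of two forms. For `z ∈ D`, take a form `F` with `F z ≠ 0` and let `ω` be `F`
of the bracket, an alternating form on `L/D` of rank 2 or 4. In rank 2, `ω = α ∧ β`, and `α ∧ ω = 0`
lets `α ⊗ F` be corrected to a cocycle. In rank 4, if `D` is not spanned by `z`, choose `F' ≠ 0` on
`D` with `F' z = 0`, and let `m` be `F'` of the bracket. For every covector `α` there is `l` with `α
∧ m = l ∧ ω`, and `α ⊗ F' - l ⊗ F` can be corrected to a cocycle that detects `z` unless `l = 0`. If
all these `l` vanish, so does `m`, a contradiction. What remains is the extra-special group of order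
`p^5`. -/

open scoped commutatorElement

/-! ### Central extensions and capability -/

/-- A normalized 2-cocycle on `G` with values in the trivial module `A`. -/
structure NormalizedCocycle (G A : Type*) [Group G] [AddCommGroup A] where
  toFun : G → G → A
  one_left : ∀ x, toFun 1 x = 0
  one_right : ∀ x, toFun x 1 = 0
  cocycle : ∀ x y z, toFun x y + toFun (x * y) z = toFun y z + toFun x (y * z)

namespace NormalizedCocycle

/-- The central extension of `G` by `A` defined by a cocycle. -/
@[ext]
structure Extension {G A : Type*} [Group G] [AddCommGroup A] (c : NormalizedCocycle G A) where
  base : G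
  fiber : A

variable {G A : Type*} [Group G] [AddCommGroup A] (c : NormalizedCocycle G A)

instance : Mul c.Extension := ⟨fun x y => ⟨x.base * y.base, x.fiber + y.fiber + c.toFun x.base y.base⟩⟩
instance : One c.Extension := ⟨⟨1, 0⟩⟩
instance : Inv c.Extension := ⟨fun x => ⟨x.base⁻¹, -x.fiber - c.toFun x.base⁻¹ x.base⟩⟩

theorem Extension.mul_def (x y : c.Extension) :
    x * y = ⟨x.base * y.base, x.fiber + y.fiber + c.toFun x.base y.base⟩ := rfl

theorem Extension.one_def : (1 : c.Extension) = ⟨1, 0⟩ := rfl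

theorem Extension.inv_def (x : c.Extension) :
    x⁻¹ = ⟨x.base⁻¹, -x.fiber - c.toFun x.base⁻¹ x.base⟩ := rfl

instance : Group c.Extension :=
  Group.ofLeftAxioms
    (by
      intro x y z
      simp only [Extension.mul_def, mul_assoc, Extension.mk.injEq, true_and]
      have h := c.cocycle x.base y.base z.base
      calc _ = x.fiber + y.fiber + z.fiber +
            (c.toFun x.base y.base + c.toFun (x.base * y.base) z.base) := by abel
        _ = _ := by rw [h]; abel)
    (by intro x; simp [Extension.mul_def, Extension.one_def, c.one_left])
    (by
      intro x
      simp only [Extension.mul_def, Extension.one_def, Extension.inv_def, inv_mul_cancel,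
        Extension.mk.injEq, true_and]
      abel)

/-- The projection of the central extension onto its base. -/
def proj : c.Extension →* G where
  toFun := Extension.base
  map_one' := rfl
  map_mul' _ _ := rfl

theorem proj_surjective : Function.Surjective c.proj := fun x => ⟨⟨x, 0⟩, rfl⟩

/-- A central element lies over a central `g`, and commuting with `⟨u, 0⟩` forces the cocycle to be
symmetric at `(u, g)`; asymmetry therefore rules out every `g ≠ 1`. -/
theorem ker_proj (h : ∀ g ∈ Subgroup.center G, g ≠ 1 → ∃ u, c.toFun u g ≠ c.toFun g u) :
    c.proj.ker = Subgroup.center c.Extension := by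
  ext x
  rw [MonoidHom.mem_ker, Subgroup.mem_center_iff]
  change x.base = 1 ↔ _
  constructor
  · intro hx y
    ext
    · simp [Extension.mul_def, hx]
    · simp [Extension.mul_def, hx, c.one_left, c.one_right, add_comm]
  · intro hx
    by_contra hne
    have hz : x.base ∈ Subgroup.center G := by
      rw [Subgroup.mem_center_iff]
      intro y
      exact congrArg Extension.base (hx ⟨y, 0⟩)
    obtain ⟨u, hu⟩ := h _ hz hne
    have := congrArg Extension.fiber (hx ⟨u, 0⟩)
    simp [Extension.mul_def] at this
    exact hu this

end NormalizedCocycle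

theorem isCapable_of_cocycles (R : Type) [AddCommGroup R] (G : Type u) [Group G]
    (h : ∀ g ∈ Subgroup.center G, g ≠ 1 →
      ∃ (c : NormalizedCocycle G R) (u : G), c.toFun u g ≠ c.toFun g u) :
    IsCapable G := by
  have h' : ∀ g : G, ∃ c : NormalizedCocycle G R,
      g ∈ Subgroup.center G → g ≠ 1 → ∃ u, c.toFun u g ≠ c.toFun g u := by
    intro g
    by_cases hg : g ∈ Subgroup.center G ∧ g ≠ 1
    · obtain ⟨c, u, hu⟩ := h g hg.1 hg.2
      exact ⟨c, fun _ _ => ⟨u, hu⟩⟩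
    · exact ⟨⟨fun _ _ => 0, by simp, by simp, by simp⟩, fun h1 h2 => absurd ⟨h1, h2⟩ hg⟩
  choose c hc using h'
  -- One coordinate for each element of `G`, so a single extension detects all of them. With `R :
  -- Type`, the coefficients `G → R` stay in the universe of `G`.
  let C : NormalizedCocycle G (G → R) :=
    { toFun := fun x y g => (c g).toFun x y
      one_left := fun x => funext fun g => (c g).one_left x
      one_right := fun x => funext fun g => (c g).one_right x
      cocycle := fun x y z => funext fun g => (c g).cocycle x y z }
  refine ⟨C.Extension, inferInstance, ⟨?_⟩⟩
  have hk : C.proj.ker = Subgroup.center C.Extension := by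
    apply C.ker_proj
    intro g hg hne
    obtain ⟨u, hu⟩ := hc g hg hne
    exact ⟨u, fun h => hu (congrFun h g)⟩
  exact ((QuotientGroup.quotientMulEquivOfEq hk).symm.trans
    (QuotientGroup.quotientKerEquivOfSurjective _ C.proj_surjective)).symm

theorem not_isCapable_of_isCyclic (G : Type u) [Group G] [IsCyclic G] [Nontrivial G] :
    ¬ IsCapable G := by
  rintro ⟨K, _, ⟨e⟩⟩
  have : IsCyclic (K ⧸ Subgroup.center K) := isCyclic_of_surjective e e.surjective
  have : IsMulCommutative K := MonoidHom.isMulCommutative_of_isCyclic_of_ker_le_center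
    (QuotientGroup.mk' (Subgroup.center K)) (by simp)
  have htop : Subgroup.center K = ⊤ := by
    rw [eq_top_iff]
    intro x _
    exact Subgroup.mem_center_iff.2 fun y => mul_comm' y x
  have : Subsingleton (K ⧸ Subgroup.center K) := by
    rw [htop]; exact QuotientGroup.subsingleton_quotient_top
  exact not_subsingleton G e.toEquiv.subsingleton


/-! ### Commutator calculus modulo the centre -/

section Commutator

variable {K : Type*} [Group K]

theorem commutatorElement_mul_left_of_mem_center {r : K} (hr : r ∈ Subgroup.center K) (a b : K) :
    ⁅r * a, b⁆ = ⁅a, b⁆ := by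
  have h : Commute r (a * b * a⁻¹) := ((Subgroup.mem_center_iff.1 hr) _).symm
  calc ⁅r * a, b⁆ = r * (a * b * a⁻¹) * r⁻¹ * b⁻¹ := by rw [commutatorElement_def]; group
    _ = ⁅a, b⁆ := by rw [h.eq, mul_inv_cancel_right, commutatorElement_def]

theorem commutatorElement_mul_right_of_mem_center {r : K} (hr : r ∈ Subgroup.center K) (a b : K) :
    ⁅a, r * b⁆ = ⁅a, b⁆ := by
  rw [← commutatorElement_inv, commutatorElement_mul_left_of_mem_center hr, commutatorElement_inv]

/-- If `x` commutes with `a` and `b` modulo the center, then it commutes with `⁅a, b⁆`. -/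
theorem commute_commutatorElement_of_mem_center {x a b : K}
    (ha : ⁅x, a⁆ ∈ Subgroup.center K) (hb : ⁅x, b⁆ ∈ Subgroup.center K) :
    Commute x ⁅a, b⁆ := by
  have ha' : x * a * x⁻¹ = ⁅x, a⁆ * a := by simp [commutatorElement_def]
  have hb' : x * b * x⁻¹ = ⁅x, b⁆ * b := by simp [commutatorElement_def]
  have key : x * ⁅a, b⁆ * x⁻¹ = ⁅a, b⁆ := by
    rw [conjugate_commutatorElement, ha', hb', commutatorElement_mul_left_of_mem_center ha,
      commutatorElement_mul_right_of_mem_center hb]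
  exact mul_inv_eq_iff_eq_mul.1 key

variable (hc : ∀ x y : K, ⁅x, y⁆ ∈ Subgroup.center K)
include hc

theorem commutatorElement_mul_left_of_central (a b c : K) : ⁅a * b, c⁆ = ⁅a, c⁆ * ⁅b, c⁆ := by
  rw [commutatorElement_mul_left_eq_conj_mul,
    Subgroup.mem_center_iff.1 (hc b c) a, mul_inv_cancel_right]
  exact Subgroup.mem_center_iff.1 (hc a c) _

theorem commutatorElement_mul_right_of_central (a b c : K) : ⁅a, b * c⁆ = ⁅a, b⁆ * ⁅a, c⁆ := by
  rw [← commutatorElement_inv, commutatorElement_mul_left_of_central hc, mul_inv_rev,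
    commutatorElement_inv, commutatorElement_inv]
  exact Subgroup.mem_center_iff.1 (hc a b) _

theorem commutatorElement_pow_right_of_central (a b : K) (n : ℕ) : ⁅a, b ^ n⁆ = ⁅a, b⁆ ^ n := by
  induction n with
  | zero => simp
  | succ n ih => rw [pow_succ, commutatorElement_mul_right_of_central hc, ih, pow_succ]

end Commutator

/-! ### The Baer correspondence -/

/-- A linearization of a group `G` of class at most two and odd exponent `p`: an `𝔽_p`-space `L`
with an alternating bilinear bracket that determines the product of `G`, as in the Baer
correspondence. -/
structure BaerModule (p : ℕ) (G L : Type*) [Group G] [AddCommGroup L] [Module (ZMod p) L] where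
  toEquiv : G ≃ L
  bracket : L →ₗ[ZMod p] L →ₗ[ZMod p] L
  half : ZMod p
  two_mul_half : 2 * half = 1
  map_mul : ∀ x y,
    toEquiv (x * y) = toEquiv x + toEquiv y + half • bracket (toEquiv x) (toEquiv y)
  map_commutator : ∀ x y, toEquiv ⁅x, y⁆ = bracket (toEquiv x) (toEquiv y)
  bracket_self : ∀ x, bracket x x = 0
  bracket_bracket : ∀ x y z, bracket (bracket x y) z = 0

/-- A group of class at most two and exponent `2 * k + 1` becomes abelian under
`x + y = x * y * ⁅x, y⁆ ^ k`, and commutators are biadditive for this operation. -/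
theorem exists_baer_addCommGroup (k : ℕ) (G : Type u) [Group G]
    (hc : ∀ x y : G, ⁅x, y⁆ ∈ Subgroup.center G) (hexp : ∀ g : G, g ^ (2 * k + 1) = 1) :
    ∃ (L : Type u) (_ : AddCommGroup L) (e : G ≃ L),
      (∀ x : L, (2 * k + 1) • x = 0) ∧
      (∀ x y, e (x * y) = e x + e y - k • e ⁅x, y⁆) ∧
      (∀ x y z, e ⁅e.symm (x + y), e.symm z⁆ = e ⁅e.symm x, e.symm z⁆ + e ⁅e.symm y, e.symm z⁆) ∧
      (∀ x y z, e ⁅e.symm x, e.symm (y + z)⁆ = e ⁅e.symm x, e.symm y⁆ + e ⁅e.symm x, e.symm z⁆) ∧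
      e 1 = 0 := by
  -- Modulo the exponent `2 * k + 1`, `k` is `-1/2`, so this is the usual Baer correction `⁅x, y⁆ ^
  -- (-1/2)`.
  let s : G → G → G := fun x y => ⁅x, y⁆ ^ k
  have hs_center : ∀ x y, s x y ∈ Subgroup.center G := fun x y => Subgroup.pow_mem _ (hc x y) k
  have hs_comm : ∀ x y z, z * s x y = s x y * z := fun x y z =>
    Subgroup.mem_center_iff.1 (hs_center x y) z
  have hmulL : ∀ x y z, s (x * y) z = s x z * s y z := fun x y z => by
    simp only [s]
    rw [commutatorElement_mul_left_of_central hc]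
    exact Commute.mul_pow (Subgroup.mem_center_iff.1 (hc y z) _) k
  have hmulR : ∀ x y z, s x (y * z) = s x y * s x z := fun x y z => by
    simp only [s]
    rw [commutatorElement_mul_right_of_central hc]
    exact Commute.mul_pow (Subgroup.mem_center_iff.1 (hc x z) _) k
  have hcentL : ∀ z ∈ Subgroup.center G, ∀ x : G, ⁅z, x⁆ = 1 := fun z hz x =>
    commutatorElement_eq_one_iff_mul_comm.2 (Subgroup.mem_center_iff.1 hz x).symm
  have hcentR : ∀ z ∈ Subgroup.center G, ∀ x : G, ⁅x, z⁆ = 1 := fun z hz x =>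
    commutatorElement_eq_one_iff_mul_comm.2 (Subgroup.mem_center_iff.1 hz x)
  have hsL : ∀ z ∈ Subgroup.center G, ∀ x : G, s z x = 1 := fun z hz x => by
    simp only [s, hcentL z hz, one_pow]
  have hsR : ∀ z ∈ Subgroup.center G, ∀ x : G, s x z = 1 := fun z hz x => by
    simp only [s, hcentR z hz, one_pow]
  -- The source of commutativity of addition: `k + 1` is `-k` modulo the exponent.
  have hss : ∀ x y, ⁅x, y⁆ * s x y = s y x := fun x y => by
    have h1 : ⁅x, y⁆ ^ (k + 1) * ⁅x, y⁆ ^ k = 1 := by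
      rw [← pow_add, show k + 1 + k = 2 * k + 1 by ring, hexp]
    simp only [s]
    rw [← pow_succ', ← commutatorElement_inv x y, inv_pow, eq_inv_iff_mul_eq_one, h1]
  have hsymm : ∀ x y, x * y * s x y = y * x * s y x := fun x y => by
    have h1 : x * y = y * x * ⁅x, y⁆ := by
      rw [Subgroup.mem_center_iff.1 (hc x y), commutatorElement_def]; group
    rw [h1, mul_assoc, hss]
  let _ : Add G := ⟨fun x y => x * y * s x y⟩
  let _ : Zero G := ⟨1⟩
  let _ : Neg G := ⟨fun x => x⁻¹⟩
  let _ : AddCommGroup G :=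
    { nsmul := nsmulRec
      zsmul := zsmulRec
      add_assoc := fun x y z => by
        change (x * y * s x y) * z * s (x * y * s x y) z = x * (y * z * s y z) * s x (y * z * s y z)
        rw [hmulL, hmulL, hsL _ (hs_center x y), hmulR, hmulR, hsR _ (hs_center y z)]
        rw [mul_one, mul_one, mul_assoc (x * y), ← hs_comm x y z]
        have h := hs_comm y z (s x y * s x z)
        simp only [mul_assoc] at h ⊢
        rw [h]
      zero_add := fun x => by
        change 1 * x * s 1 x = x
        simp [s]
      add_zero := fun x => by
        change x * 1 * s x 1 = x
        simp [s]
      neg_add_cancel := fun x => by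
        change x⁻¹ * x * s x⁻¹ x = 1
        have : s x⁻¹ x = 1 := by
          simp only [s]; rw [commutatorElement_eq_one_iff_mul_comm.2 (by simp), one_pow]
        rw [this]; simp
      add_comm := hsymm }
  have add_def : ∀ x y : G, x + y = x * y * s x y := fun _ _ => rfl
  have zero_def : (0 : G) = 1 := rfl
  have hnsmul : ∀ (n : ℕ) (x : G), n • x = x ^ n := by
    intro n x
    induction n with
    | zero => simp [zero_def]
    | succ n ih =>
      rw [succ_nsmul, ih, add_def, pow_succ]
      have : s (x ^ n) x = 1 := by
        simp only [s]
        rw [commutatorElement_eq_one_iff_mul_comm.2 (by rw [← pow_succ, pow_succ']), one_pow]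
      rw [this, mul_one]
  have add_center : ∀ x : G, ∀ z ∈ Subgroup.center G, x + z = x * z := fun x z hz => by
    rw [add_def, hsR z hz, mul_one]
  refine ⟨G, inferInstance, Equiv.refl G, ?_, ?_, ?_, ?_, ?_⟩
  · intro x; rw [hnsmul, hexp, zero_def]
  · intro x y
    simp only [Equiv.refl_apply]
    rw [eq_sub_iff_add_eq, hnsmul, add_center _ _ (hs_center x y), add_def]
  · intro x y z
    simp only [Equiv.refl_apply, Equiv.refl_symm]
    rw [add_center _ _ (hc y z), add_def, commutatorElement_mul_left_of_central hc,
      commutatorElement_mul_left_of_central hc, hcentL _ (hs_center x y), mul_one]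
  · intro x y z
    simp only [Equiv.refl_apply, Equiv.refl_symm]
    rw [add_center _ _ (hc x z), add_def, commutatorElement_mul_right_of_central hc,
      commutatorElement_mul_right_of_central hc, hcentR _ (hs_center y z), mul_one]
  · exact zero_def.symm

/-- The Baer correspondence for groups of class at most two and odd prime exponent. -/
theorem exists_baerModule (p : ℕ) (hodd : Odd p) (G : Type u) [Group G]
    (hc : ∀ x y : G, ⁅x, y⁆ ∈ Subgroup.center G) (hexp : ∀ g : G, g ^ p = 1) :
    ∃ (L : Type u) (_ : AddCommGroup L) (_ : Module (ZMod p) L), Nonempty (BaerModule p G L) := by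
  obtain ⟨k, rfl⟩ := hodd
  obtain ⟨L, _, e, hL, hmul, hBL, hBR, h1⟩ := exists_baer_addCommGroup k G hc hexp
  let _ : Module (ZMod (2 * k + 1)) L := AddCommGroup.zmodModule hL
  let B₀ : L →+ L →+ L := AddMonoidHom.mk'
    (fun x => AddMonoidHom.mk' (fun y => e ⁅e.symm x, e.symm y⁆) (hBR x))
    (fun x y => by ext z; exact hBL x y z)
  let B : L →ₗ[ZMod (2 * k + 1)] L →ₗ[ZMod (2 * k + 1)] L :=
    LinearMap.mk₂ (ZMod (2 * k + 1)) (fun x y => e ⁅e.symm x, e.symm y⁆)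
      hBL (fun a x z => ZMod.map_smul (AddMonoidHom.flip B₀ z) a x)
      hBR (fun a x z => ZMod.map_smul (B₀ x) a z)
  have hB : ∀ x y : L, B x y = e ⁅e.symm x, e.symm y⁆ := fun _ _ => rfl
  have hkp : 2 * (-(k : ZMod (2 * k + 1))) = 1 := by
    have : ((2 * k + 1 : ℕ) : ZMod (2 * k + 1)) = 0 := ZMod.natCast_self _
    push_cast at this
    linear_combination -this
  refine ⟨L, inferInstance, inferInstance, ⟨⟨e, B, -(k : ZMod (2 * k + 1)), hkp, ?_, ?_, ?_, ?_⟩⟩⟩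
  · intro x y
    rw [hmul, hB, neg_smul, ← sub_eq_add_neg, Nat.cast_smul_eq_nsmul, e.symm_apply_apply,
      e.symm_apply_apply]
  · intro x y; rw [hB, e.symm_apply_apply, e.symm_apply_apply]
  · intro x; rw [hB, commutatorElement_self, h1]
  · intro x y z
    rw [hB, hB, e.symm_apply_apply, commutatorElement_eq_one_iff_mul_comm.2
      (Subgroup.mem_center_iff.1 (hc _ _) _).symm, h1]

namespace BaerModule

variable {p : ℕ} {G L : Type*} [Group G] [AddCommGroup L] [Module (ZMod p) L]
  (M : BaerModule p G L)

/-- The span of all brackets. -/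
def derived : Submodule (ZMod p) L := Submodule.span (ZMod p) (Set.range fun x : L × L => M.bracket x.1 x.2)

theorem bracket_mem_derived (x y : L) : M.bracket x y ∈ M.derived :=
  Submodule.subset_span ⟨(x, y), rfl⟩

theorem bracket_eq_zero_of_mem_derived {d : L} (hd : d ∈ M.derived) : M.bracket d = 0 := by
  have : M.derived ≤ LinearMap.ker M.bracket := by
    rw [derived, Submodule.span_le]
    rintro _ ⟨x, rfl⟩
    exact LinearMap.ext fun z => M.bracket_bracket _ _ z
  exact this hd

theorem bracket_neg (x y : L) : -M.bracket x y = M.bracket y x :=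
  LinearMap.IsAlt.neg (B := M.bracket) M.bracket_self x y

theorem toEquiv_one : M.toEquiv 1 = 0 := by
  have h := M.map_mul 1 1
  rw [M.bracket_self, smul_zero, mul_one, add_zero] at h
  exact left_eq_add.1 h

theorem toEquiv_pow (x : G) (n : ℕ) : M.toEquiv (x ^ n) = n • M.toEquiv x := by
  induction n with
  | zero => simp [M.toEquiv_one]
  | succ n ih =>
    rw [pow_succ, M.map_mul, ih, map_nsmul, LinearMap.smul_apply, M.bracket_self]
    simp [succ_nsmul]

theorem toEquiv_inv (x : G) : M.toEquiv x⁻¹ = -M.toEquiv x := by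
  have h := M.map_mul x⁻¹ x
  have h' := M.map_commutator x⁻¹ x
  rw [commutatorElement_eq_one_iff_mul_comm.2 (by simp), M.toEquiv_one] at h'
  rw [← h', inv_mul_cancel, M.toEquiv_one, smul_zero, add_zero] at h
  exact eq_neg_of_add_eq_zero_left h.symm

theorem mem_center_iff (g : G) : g ∈ Subgroup.center G ↔ M.bracket (M.toEquiv g) = 0 := by
  rw [Subgroup.mem_center_iff]
  constructor
  · intro h
    ext y
    obtain ⟨y, rfl⟩ := M.toEquiv.surjective y
    rw [← M.map_commutator, commutatorElement_eq_one_iff_mul_comm.2 (h y).symm, M.toEquiv_one]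
    rfl
  · intro h y
    have := M.map_commutator g y
    rw [h, LinearMap.zero_apply, ← M.toEquiv_one] at this
    exact (commutatorElement_eq_one_iff_mul_comm.1 (M.toEquiv.injective this)).symm

/-- Elements of `L` that generate `G` span `L` modulo brackets. -/
theorem span_quotient_eq_top {ι : Type*} (g : ι → G) (hg : Subgroup.closure (Set.range g) = ⊤) :
    Submodule.span (ZMod p) (Set.range fun i => M.derived.mkQ (M.toEquiv (g i))) = ⊤ := by
  set S := Submodule.span (ZMod p) (Set.range fun i => M.derived.mkQ (M.toEquiv (g i)))
  have hbr : ∀ x y, M.derived.mkQ (M.bracket x y) = 0 := fun x y => by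
    simpa using M.bracket_mem_derived x y
  have h : ∀ x : G, M.derived.mkQ (M.toEquiv x) ∈ S := by
    intro x
    have hx : x ∈ Subgroup.closure (Set.range g) := hg ▸ Subgroup.mem_top x
    induction hx using Subgroup.closure_induction with
    | mem x hx =>
      obtain ⟨i, rfl⟩ := hx
      exact Submodule.subset_span ⟨i, rfl⟩
    | one => rw [M.toEquiv_one, map_zero]; exact S.zero_mem
    | mul x y _ _ hx hy =>
      rw [M.map_mul, map_add, map_add, map_smul, hbr, smul_zero, add_zero]
      exact S.add_mem hx hy
    | inv x _ hx => rw [M.toEquiv_inv, map_neg]; exact S.neg_mem hx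
  rw [eq_top_iff]
  intro q _
  obtain ⟨y, rfl⟩ := M.derived.mkQ_surjective q
  obtain ⟨x, rfl⟩ := M.toEquiv.surjective y
  exact h x

/-- A function on pairs of vectors defines a cocycle on `G` once the identities hold in `L`. -/
theorem exists_cocycle (C : L → L → ZMod p) (h0 : ∀ x, C 0 x = 0) (h1 : ∀ x, C x 0 = 0)
    (h : ∀ x y z, C x y + C (x + y + M.half • M.bracket x y) z =
      C y z + C x (y + z + M.half • M.bracket y z)) :
    ∃ c : NormalizedCocycle G (ZMod p), ∀ x y, c.toFun x y = C (M.toEquiv x) (M.toEquiv y) :=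
  ⟨{toFun := fun x y => C (M.toEquiv x) (M.toEquiv y)
    one_left := fun x => by rw [M.toEquiv_one, h0]
    one_right := fun x => by rw [M.toEquiv_one, h1]
    cocycle := fun x y z => by simp only [M.map_mul]; exact h _ _ _ }, fun _ _ => rfl⟩

/-! ### Polynomial cocycles that detect central elements -/

/-- `z : L` is detected if some central extension of `G` by `𝔽_p` has no central element over it. -/
def Detected (z : L) : Prop :=
  ∃ (c : NormalizedCocycle G (ZMod p)) (u : G), c.toFun u (M.toEquiv.symm z) ≠ c.toFun (M.toEquiv.symm z) u

theorem detected_of (C : L → L → ZMod p) (h0 : ∀ x, C 0 x = 0) (h1 : ∀ x, C x 0 = 0)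
    (h : ∀ x y z, C x y + C (x + y + M.half • M.bracket x y) z =
      C y z + C x (y + z + M.half • M.bracket y z)) {z : L} (u : L) (hu : C u z ≠ C z u) :
    M.Detected z := by
  obtain ⟨c, hc⟩ := M.exists_cocycle C h0 h1 h
  refine ⟨c, M.toEquiv.symm u, ?_⟩
  simpa [hc] using hu

theorem detected_of_linear (α β : L →ₗ[ZMod p] ZMod p) (hα : ∀ x y, α (M.bracket x y) = 0)
    (hβ : ∀ x y, β (M.bracket x y) = 0) {z : L} (u : L) (hu : α u * β z ≠ α z * β u) :
    M.Detected z := by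
  refine M.detected_of (fun x y => α x * β y) (by simp) (by simp) (fun x y z => ?_) u hu
  simp only [map_add, map_smul, hα, hβ, smul_eq_mul]
  ring

/-- Since `α ∧ α ∧ β = 0`, the failure of `α ⊗ F` to be a cocycle is the coboundary of a cubic in
`α`, `β`. The cubic needs no denominator beyond the `half` in the group law, so `p = 3` is no
exception. It vanishes at `(u, z)` and `(z, u)`, where only `α u * F z` survives. -/
theorem detected_of_rank_two (α β F : L →ₗ[ZMod p] ZMod p) (hα : ∀ x y, α (M.bracket x y) = 0)
    (hβ : ∀ x y, β (M.bracket x y) = 0)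
    (hF : ∀ x y, F (M.bracket x y) = α x * β y - β x * α y)
    {z : L} (hzα : α z = 0) (hzβ : β z = 0) (hzF : F z ≠ 0) {u : L} (hu : α u = 1) :
    M.Detected z := by
  refine M.detected_of
    (fun x y => α x * F y + M.half * (α x ^ 2 * β y + α x * α y * β y)) (by simp) (by simp)
    (fun x y z => ?_) u (by simpa [hzα, hzβ, hu] using hzF)
  simp only [map_add, map_smul, hα, hβ, hF, smul_eq_mul]
  ring

/-- Detection through two linear forms `F`, `F'` such that the bracket is nondegenerate under `F`.
The cubic terms trivialize `α ⊗ F' + l ⊗ F`, where `l ∧ F + α ∧ F' = 0`. -/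
theorem detected_of_rank_four [Fact p.Prime] (α β γ δ F F' : L →ₗ[ZMod p] ZMod p)
    (hα : ∀ x y, α (M.bracket x y) = 0) (hβ : ∀ x y, β (M.bracket x y) = 0)
    (hγ : ∀ x y, γ (M.bracket x y) = 0) (hδ : ∀ x y, δ (M.bracket x y) = 0)
    (hF : ∀ x y, F (M.bracket x y) = α x * β y - β x * α y + (γ x * δ y - δ x * γ y))
    (m₁₂ m₁₃ m₁₄ m₂₃ m₂₄ m₃₄ : ZMod p)
    (hF' : ∀ x y, F' (M.bracket x y) =
      m₁₂ * (α x * β y - β x * α y) + m₁₃ * (α x * γ y - γ x * α y) +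
      m₁₄ * (α x * δ y - δ x * α y) + m₂₃ * (β x * γ y - γ x * β y) +
      m₂₄ * (β x * δ y - δ x * β y) + m₃₄ * (γ x * δ y - δ x * γ y))
    {z : L} (hzα : α z = 0) (hzβ : β z = 0) (hzγ : γ z = 0) (hzδ : δ z = 0)
    (hzF : F z ≠ 0) (hzF' : F' z = 0) {u : L} (hu : m₃₄ * α u + m₂₃ * γ u + m₂₄ * δ u ≠ 0) :
    M.Detected z := by
  refine M.detected_of
    (fun x y => α x * F' y - (m₃₄ * α x + m₂₃ * γ x + m₂₄ * δ x) * F y +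
      M.half * ((m₁₂ - m₃₄) * (α x ^ 2 * β y + α x * α y * β y)
        + m₁₃ * (α x ^ 2 * γ y + α x * α y * γ y) + m₁₄ * (α x ^ 2 * δ y + α x * α y * δ y)
        - m₂₃ * (α x * β y * γ y + γ x * α y * β y + 2 * α x * γ x * β y
            + γ x ^ 2 * δ y + γ x * γ y * δ y)
        - m₂₄ * (α x * β y * δ y + δ x * α y * β y + 2 * α x * δ x * β y
            - δ x ^ 2 * γ y - δ x * δ y * γ y)))
    (by simp) (by simp) (fun x y z => ?_) u ?_
  · simp only [map_add, map_smul, hα, hβ, hγ, hδ, hF, hF', smul_eq_mul]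
    ring
  -- All terms vanish at `(z, u)`, and only `-l u * F z` survives at `(u, z)`, where `l = m₃₄ α +
  -- m₂₃ γ + m₂₄ δ` solves `α ∧ m = l ∧ (α ∧ β + γ ∧ δ)`.
  · simp only [hzα, hzβ, hzγ, hzδ, hzF']
    intro h
    exact mul_ne_zero hu hzF (by linear_combination -h)

end BaerModule

/-! ### Which central elements are detected -/

/-- Vectors with a dual system of forms that vanish on `D` are a basis modulo `D`, if there are
enough of them. -/
theorem finrank_quotient_eq_and_sub_sum_mem {k L ι : Type*} [Field k] [AddCommGroup L] [Module k L]
    [Fintype ι] [DecidableEq ι] (D : Submodule k L) [Module.Finite k (L ⧸ D)]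
    (hD : Module.finrank k (L ⧸ D) ≤ Fintype.card ι) (a : ι → L) (ξ : ι → L →ₗ[k] k)
    (hξ : ∀ i, D ≤ LinearMap.ker (ξ i)) (hdual : ∀ i j, ξ i (a j) = if i = j then 1 else 0) :
    Module.finrank k (L ⧸ D) = Fintype.card ι ∧ ∀ v, v - ∑ i, ξ i v • a i ∈ D := by
  have hcoord : ∀ (c : ι → k) (v : L), v - ∑ i, c i • a i ∈ D → ∀ j, ξ j v = c j := by
    intro c v hv j
    have h := hξ j hv
    rw [LinearMap.mem_ker, map_sub, sub_eq_zero] at h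
    simpa [hdual] using h
  have hli : LinearIndependent k fun i => D.mkQ (a i) := by
    rw [Fintype.linearIndependent_iff]
    intro c hc j
    have hmem : 0 - ∑ i, c i • a i ∈ D := by
      rw [← Submodule.Quotient.mk_eq_zero, ← Submodule.mkQ_apply, map_sub, map_sum]
      simpa only [map_smul, map_zero, zero_sub, neg_eq_zero] using hc
    rw [← hcoord c 0 hmem j, map_zero]
  have hcard : Fintype.card ι = Module.finrank k (L ⧸ D) :=
    le_antisymm hli.fintype_card_le_finrank hD
  refine ⟨hcard.symm, fun v => ?_⟩
  have hspan := hli.span_eq_top_of_card_eq_finrank' hcard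
  have hv : D.mkQ v ∈ Submodule.span k (Set.range fun i => D.mkQ (a i)) := hspan ▸ Submodule.mem_top
  obtain ⟨c, hc⟩ := (Submodule.mem_span_range_iff_exists_fun k).1 hv
  have hmem : v - ∑ i, c i • a i ∈ D := by
    rw [← Submodule.Quotient.mk_eq_zero, ← Submodule.mkQ_apply, map_sub, ← hc]
    simp
  simpa only [hcoord c v hmem] using hmem

namespace BaerModule

variable {p : ℕ} {G L : Type*} [Group G] [AddCommGroup L] [Module (ZMod p) L]
  (M : BaerModule p G L)

theorem bracket_right_eq_zero {x : L} (hx : M.bracket x = 0) (y : L) : M.bracket y x = 0 := by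
  rw [← M.bracket_neg, hx, LinearMap.zero_apply, neg_zero]

theorem apply_derived_eq_zero {F : L →ₗ[ZMod p] ZMod p} (hF : ∀ x y, F (M.bracket x y) = 0) :
    M.derived ≤ LinearMap.ker F := by
  rw [derived, Submodule.span_le]
  rintro _ ⟨x, rfl⟩
  exact hF _ _

include M in
theorem isCyclic_of_span_eq_top [Fact p.Prime] {z : L} (hz : Submodule.span (ZMod p) {z} = ⊤) :
    IsCyclic G := by
  refine ⟨⟨M.toEquiv.symm z, fun x => ?_⟩⟩
  have hx : M.toEquiv x ∈ Submodule.span (ZMod p) {z} := hz ▸ Submodule.mem_top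
  obtain ⟨a, ha⟩ := Submodule.mem_span_singleton.1 hx
  refine ⟨(a.val : ℤ), M.toEquiv.injective ?_⟩
  change M.toEquiv (_ ^ (a.val : ℤ)) = _
  rw [zpow_natCast, M.toEquiv_pow, Equiv.apply_symm_apply, ← ha, ← Nat.cast_smul_eq_nsmul (ZMod p),
    ZMod.natCast_zmod_val]

/-- A central element outside the derived subgroup is detected unless the group is cyclic. -/
theorem detected_of_notMem_derived [Fact p.Prime] (hG : ¬ IsCyclic G) {z : L}
    (hz : M.bracket z = 0) (hzD : z ∉ M.derived) : M.Detected z := by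
  obtain ⟨α, hαz, hα⟩ := Submodule.exists_le_ker_of_notMem hzD
  -- If `z` spans `L` modulo brackets, the bracket vanishes and `L` is a line. Otherwise there is
  -- room for a second form `β` that kills `z`.
  by_cases htop : M.derived ⊔ Submodule.span (ZMod p) {z} = ⊤
  · exfalso
    have hbr : ∀ x, M.bracket x = 0 := by
      intro x
      have hle : M.derived ⊔ Submodule.span (ZMod p) {z} ≤ LinearMap.ker M.bracket :=
        sup_le (fun d hd => M.bracket_eq_zero_of_mem_derived hd)
          ((Submodule.span_singleton_le_iff_mem _ _).2 hz)
      exact hle (htop ▸ Submodule.mem_top)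
    have hD : M.derived = ⊥ := by
      rw [derived, Submodule.span_eq_bot]
      rintro _ ⟨x, rfl⟩
      simp [hbr]
    rw [hD, bot_sup_eq] at htop
    exact hG (M.isCyclic_of_span_eq_top htop)
  · obtain ⟨β, hβ0, hβ⟩ := Submodule.exists_le_ker_of_lt_top _ (lt_top_iff_ne_top.2 htop)
    obtain ⟨u, hu⟩ : ∃ u, β u ≠ 0 := by
      by_contra! h
      exact hβ0 (LinearMap.ext h)
    have hβz : β z = 0 := hβ (Submodule.mem_sup_right (Submodule.mem_span_singleton_self z))
    refine M.detected_of_linear α β (fun x y => hα (M.bracket_mem_derived x y))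
      (fun x y => hβ (Submodule.mem_sup_left (M.bracket_mem_derived x y))) u ?_
    rw [hβz, mul_zero]
    exact (mul_ne_zero hαz hu).symm

theorem apply_bracket_expand (F : L →ₗ[ZMod p] ZMod p) {a₁ a₂ a₃ a₄ d d' : L}
    (hd : d ∈ M.derived) (hd' : d' ∈ M.derived) (x₁ x₂ x₃ x₄ y₁ y₂ y₃ y₄ : ZMod p) :
    F (M.bracket (x₁ • a₁ + x₂ • a₂ + x₃ • a₃ + x₄ • a₄ + d)
        (y₁ • a₁ + y₂ • a₂ + y₃ • a₃ + y₄ • a₄ + d')) =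
      F (M.bracket a₁ a₂) * (x₁ * y₂ - x₂ * y₁) + F (M.bracket a₁ a₃) * (x₁ * y₃ - x₃ * y₁) +
      F (M.bracket a₁ a₄) * (x₁ * y₄ - x₄ * y₁) + F (M.bracket a₂ a₃) * (x₂ * y₃ - x₃ * y₂) +
      F (M.bracket a₂ a₄) * (x₂ * y₄ - x₄ * y₂) + F (M.bracket a₃ a₄) * (x₃ * y₄ - x₄ * y₃) := by
  have h := M.bracket_eq_zero_of_mem_derived hd
  have h' := fun x => M.bracket_right_eq_zero (M.bracket_eq_zero_of_mem_derived hd') x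
  simp only [map_add, map_smul, LinearMap.add_apply, LinearMap.smul_apply, h, h', M.bracket_self,
    LinearMap.zero_apply, ← M.bracket_neg a₁ a₂, ← M.bracket_neg a₁ a₃, ← M.bracket_neg a₁ a₄,
    ← M.bracket_neg a₂ a₃, ← M.bracket_neg a₂ a₄, ← M.bracket_neg a₃ a₄, map_neg, map_zero,
    smul_eq_mul]
  ring

/-- For at most four generators, a central element of the derived subgroup is detected unless it
spans the derived subgroup and the bracket is a symplectic form on a four-dimensional space. -/
theorem detected_or_symplectic [Fact p.Prime] [Module.Finite (ZMod p) (L ⧸ M.derived)]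
    (hfin : Module.finrank (ZMod p) (L ⧸ M.derived) ≤ 4) {z : L} (hz0 : z ≠ 0)
    (hz : M.bracket z = 0) (hzD : z ∈ M.derived) :
    M.Detected z ∨ (Module.finrank (ZMod p) (L ⧸ M.derived) = 4 ∧
      M.derived = Submodule.span (ZMod p) {z} ∧ ∀ v, M.bracket v = 0 → v ∈ M.derived) := by
  rw [or_iff_not_imp_left]
  intro hnd
  obtain ⟨F, hFz, -⟩ := Submodule.exists_le_ker_of_notMem
    (show z ∉ (⊥ : Submodule (ZMod p) L) by simpa using hz0)
  set f := M.bracket.compr₂ F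
  have f_apply : ∀ x y, f x y = F (M.bracket x y) := fun _ _ => rfl
  have f_self : ∀ x, f x x = 0 := fun x => by rw [f_apply, M.bracket_self, map_zero]
  have f_neg : ∀ x y, f x y = -f y x := fun x y => by
    rw [f_apply, f_apply, ← M.bracket_neg, map_neg]
  have f_zero : ∀ x y, M.bracket x = 0 → f x y = 0 := fun x y h => by simp [f_apply, h]
  have f_zero' : ∀ x y, M.bracket x = 0 → f y x = 0 := fun x y h => by
    rw [f_neg, f_zero x y h, neg_zero]
  have br0 : ∀ x y, M.bracket (M.bracket x y) = 0 := fun x y =>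
    LinearMap.ext fun w => M.bracket_bracket x y w
  obtain ⟨a₁, a₂, h12⟩ : ∃ x y, f x y = 1 := by
    obtain ⟨x, y, hxy⟩ : ∃ x y, f x y ≠ 0 := by
      by_contra! h
      exact hFz (M.apply_derived_eq_zero h hzD)
    exact ⟨(f x y)⁻¹ • x, y, by simp [inv_mul_cancel₀ hxy]⟩
  have h21 : f a₂ a₁ = -1 := by rw [f_neg, h12]
  -- If `f` is `α ∧ β` for the coordinate forms of `a₁`, `a₂`, the rank-two cocycle detects `z`.
  -- Otherwise project a pair `v`, `w` on which they differ to the orthogonal complement of `a₁`,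
  -- `a₂`, and rescale.
  obtain ⟨a₃, a₄, h34, h13, h14, h23, h24⟩ : ∃ a₃ a₄, f a₃ a₄ = 1 ∧ f a₁ a₃ = 0 ∧ f a₁ a₄ = 0 ∧
      f a₂ a₃ = 0 ∧ f a₂ a₄ = 0 := by
    obtain ⟨v, w, hvw⟩ : ∃ v w, f v w - (f v a₂ * f a₁ w - f a₁ v * f w a₂) ≠ 0 := by
      by_contra! h
      exact hnd (M.detected_of_rank_two (f.flip a₂) (f a₁) F (fun x y => f_zero _ _ (br0 x y))
        (fun x y => f_zero' _ _ (br0 x y)) (fun x y => sub_eq_zero.1 (h x y)) (f_zero _ _ hz)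
        (f_zero' _ _ hz) hFz (u := a₁) h12)
    refine ⟨v - f v a₂ • a₁ - f a₁ v • a₂,
      (f v w - (f v a₂ * f a₁ w - f a₁ v * f w a₂))⁻¹ • (w - f w a₂ • a₁ - f a₁ w • a₂),
      ?_, ?_, ?_, ?_, ?_⟩
    · rw [map_smul, smul_eq_mul, inv_mul_eq_one₀ hvw]
      simp only [map_sub, map_smul, LinearMap.sub_apply, LinearMap.smul_apply, smul_eq_mul, f_self,
        h12, h21, f_neg v a₁, f_neg a₂ w]
      ring
    all_goals
      simp only [map_sub, map_smul, smul_eq_mul, f_self, h12, h21, f_neg a₂ v, f_neg a₂ w]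
      ring
  have h31 : f a₃ a₁ = 0 := by rw [f_neg, h13, neg_zero]
  have h32 : f a₃ a₂ = 0 := by rw [f_neg, h23, neg_zero]
  have h42 : f a₄ a₂ = 0 := by rw [f_neg, h24, neg_zero]
  -- The coordinate forms of a symplectic basis are pairings with its partner vectors; four vectors
  -- suffice because the quotient has dimension at most four.
  obtain ⟨hrank, hbasis⟩ := finrank_quotient_eq_and_sub_sum_mem M.derived (by simpa using hfin)
    ![a₁, a₂, a₃, a₄] ![f.flip a₂, f a₁, f.flip a₄, f a₃]
    (fun i => M.apply_derived_eq_zero fun x y => by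
      fin_cases i
      · exact f_zero _ _ (br0 x y)
      · exact f_zero' _ _ (br0 x y)
      · exact f_zero _ _ (br0 x y)
      · exact f_zero' _ _ (br0 x y))
    (fun i j => by
      fin_cases i <;> fin_cases j <;>
        simp [f_self, h12, h13, h14, h24, h31, h32, h34, h42])
  have hdecomp : ∀ v, ∃ d ∈ M.derived,
      v = f v a₂ • a₁ + f a₁ v • a₂ + f v a₄ • a₃ + f a₃ v • a₄ + d := fun v =>
    ⟨_, hbasis v, by simp [Fin.sum_univ_four]⟩
  have hexpand : ∀ (F' : L →ₗ[ZMod p] ZMod p) (v w : L), F' (M.bracket v w) =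
      F' (M.bracket a₁ a₂) * (f v a₂ * f a₁ w - f a₁ v * f w a₂) +
      F' (M.bracket a₁ a₃) * (f v a₂ * f w a₄ - f v a₄ * f w a₂) +
      F' (M.bracket a₁ a₄) * (f v a₂ * f a₃ w - f a₃ v * f w a₂) +
      F' (M.bracket a₂ a₃) * (f a₁ v * f w a₄ - f v a₄ * f a₁ w) +
      F' (M.bracket a₂ a₄) * (f a₁ v * f a₃ w - f a₃ v * f a₁ w) +
      F' (M.bracket a₃ a₄) * (f v a₄ * f a₃ w - f a₃ v * f w a₄) := by
    intro F' v w
    obtain ⟨d, hd, hv⟩ := hdecomp v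
    obtain ⟨d', hd', hw⟩ := hdecomp w
    have := M.apply_bracket_expand F' (a₁ := a₁) (a₂ := a₂) (a₃ := a₃) (a₄ := a₄) hd hd'
      (f v a₂) (f a₁ v) (f v a₄) (f a₃ v) (f w a₂) (f a₁ w) (f w a₄) (f a₃ w)
    rwa [← hv, ← hw] at this
  have hcenter : ∀ v, M.bracket v = 0 → v ∈ M.derived := by
    intro v hv
    obtain ⟨d, hd, hvd⟩ := hdecomp v
    rw [f_zero _ _ hv, f_zero' _ _ hv, f_zero _ _ hv, f_zero' _ _ hv] at hvd
    rw [hvd]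
    simpa using hd
  refine ⟨by simpa using hrank, le_antisymm ?_ ((Submodule.span_singleton_le_iff_mem _ _).2 hzD),
    hcenter⟩
  by_contra hle
  obtain ⟨d, hd, hdz⟩ := SetLike.not_le_iff_exists.1 hle
  obtain ⟨F', hF'd, hF'⟩ := Submodule.exists_le_ker_of_notMem hdz
  have hF'z : F' z = 0 := hF' (Submodule.mem_span_singleton_self z)
  have hF_expand : ∀ v w, F (M.bracket v w) =
      f v a₂ * f a₁ w - f a₁ v * f w a₂ + (f v a₄ * f a₃ w - f a₃ v * f w a₄) := by
    intro v w
    rw [hexpand F v w, ← f_apply, ← f_apply, ← f_apply, ← f_apply, ← f_apply, ← f_apply,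
      h12, h13, h14, h23, h24, h34]
    ring
  have hα : ∀ x y, f.flip a₂ (M.bracket x y) = 0 := fun x y => f_zero _ _ (br0 x y)
  have hβ : ∀ x y, f a₁ (M.bracket x y) = 0 := fun x y => f_zero' _ _ (br0 x y)
  have hγ : ∀ x y, f.flip a₄ (M.bracket x y) = 0 := fun x y => f_zero _ _ (br0 x y)
  have hδ : ∀ x y, f a₃ (M.bracket x y) = 0 := fun x y => f_zero' _ _ (br0 x y)
  have hzα : f.flip a₂ z = 0 := f_zero _ _ hz
  have hzβ : f a₁ z = 0 := f_zero' _ _ hz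
  have hzγ : f.flip a₄ z = 0 := f_zero _ _ hz
  have hzδ : f a₃ z = 0 := f_zero' _ _ hz
  obtain ⟨m₁₂, m₁₃, m₁₄, m₂₃, m₂₄, m₃₄, hm⟩ : ∃ m₁₂ m₁₃ m₁₄ m₂₃ m₂₄ m₃₄ : ZMod p,
      ∀ v w, F' (M.bracket v w) =
        m₁₂ * (f v a₂ * f a₁ w - f a₁ v * f w a₂) + m₁₃ * (f v a₂ * f w a₄ - f v a₄ * f w a₂) +
        m₁₄ * (f v a₂ * f a₃ w - f a₃ v * f w a₂) + m₂₃ * (f a₁ v * f w a₄ - f v a₄ * f a₁ w) +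
        m₂₄ * (f a₁ v * f a₃ w - f a₃ v * f a₁ w) + m₃₄ * (f v a₄ * f a₃ w - f a₃ v * f w a₄) :=
    ⟨_, _, _, _, _, _, hexpand F'⟩
  -- Non-detection forces `l = 0`. The next two claims use the symplectic changes of coordinates
  -- `(β, -α, γ, δ)` and `(γ, δ, α, β)`, which put another covector in the role of `α`; the three
  -- together kill all six coefficients.
  have hc1 : ∀ u, m₃₄ * f u a₂ + m₂₃ * f u a₄ + m₂₄ * f a₃ u = 0 := by
    intro u
    by_contra hu
    exact hnd (M.detected_of_rank_four (f.flip a₂) (f a₁) (f.flip a₄) (f a₃) F F' hα hβ hγ hδ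
      hF_expand _ _ _ _ _ _ hm hzα hzβ hzγ hzδ hFz hF'z hu)
  have hc2 : ∀ u, m₃₄ * f a₁ u + -m₁₃ * f u a₄ + -m₁₄ * f a₃ u = 0 := by
    intro u
    by_contra hu
    refine hnd (M.detected_of_rank_four (f a₁) (-f.flip a₂) (f.flip a₄) (f a₃) F F' hβ
      (fun x y => by rw [LinearMap.neg_apply, hα, neg_zero]) hγ hδ
      (fun x y => ?_) m₁₂ m₂₃ m₂₄ (-m₁₃) (-m₁₄) m₃₄ (fun x y => ?_) hzβ
      (by rw [LinearMap.neg_apply, hzα, neg_zero]) hzγ hzδ hFz hF'z hu)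
    · rw [hF_expand, LinearMap.neg_apply, LinearMap.neg_apply, LinearMap.flip_apply,
        LinearMap.flip_apply, LinearMap.flip_apply, LinearMap.flip_apply]
      ring
    · rw [hm, LinearMap.neg_apply, LinearMap.neg_apply, LinearMap.flip_apply,
        LinearMap.flip_apply, LinearMap.flip_apply, LinearMap.flip_apply]
      ring
  have hc3 : ∀ u, m₁₂ * f u a₄ + -m₁₄ * f u a₂ + -m₂₄ * f a₁ u = 0 := by
    intro u
    by_contra hu
    refine hnd (M.detected_of_rank_four (f.flip a₄) (f a₃) (f.flip a₂) (f a₁) F F' hγ hδ hα hβ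
      (fun x y => ?_) m₃₄ (-m₁₃) (-m₂₃) (-m₁₄) (-m₂₄) m₁₂ (fun x y => ?_) hzγ hzδ hzα hzβ hFz hF'z
      hu)
    · rw [hF_expand, LinearMap.flip_apply, LinearMap.flip_apply, LinearMap.flip_apply,
        LinearMap.flip_apply]
      ring
    · rw [hm, LinearMap.flip_apply, LinearMap.flip_apply, LinearMap.flip_apply,
        LinearMap.flip_apply]
      ring
  have e₃₄ : m₃₄ = 0 := by simpa [h12, h14, h31] using hc1 a₁
  have e₂₃ : m₂₃ = 0 := by simpa [h32, h34, f_self] using hc1 a₃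
  have e₂₄ : m₂₄ = 0 := by simpa [h42, h34, f_self] using hc1 a₄
  have e₁₃ : m₁₃ = 0 := by simpa [h13, h34, f_self] using hc2 a₃
  have e₁₄ : m₁₄ = 0 := by simpa [h14, h34, f_self] using hc2 a₄
  have e₁₂ : m₁₂ = 0 := by simpa [h34, h32, h13] using hc3 a₃
  refine hF'd (M.apply_derived_eq_zero (fun x y => ?_) hd)
  rw [hm, e₁₂, e₁₃, e₁₄, e₂₃, e₂₄, e₃₄]
  ring

end BaerModule

/-! ### Extra-special groups of order `p ^ 5` are not capable -/

theorem IsExtraSpecial.commutatorElement_mem_center {p : ℕ} {G : Type u} [Group G]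
    (hG : IsExtraSpecial p G) (x y : G) : ⁅x, y⁆ ∈ Subgroup.center G := by
  rw [← QuotientGroup.eq_one_iff, ← QuotientGroup.mk'_apply, map_commutatorElement,
    commutatorElement_eq_one_iff_mul_comm]
  exact hG.comm_quotient _ _

/-- In an extra-special group of order `p ^ 5` the centralizer of every element is nonabelian. -/
theorem IsExtraSpecial.exists_commute_commutatorElement_ne_one {p : ℕ} (hp : p.Prime) {G : Type u}
    [Group G] (hG : IsExtraSpecial p G) (hcard : Nat.card G = p ^ 5) (u : G) :
    ∃ a b : G, ⁅u, a⁆ = 1 ∧ ⁅u, b⁆ = 1 ∧ ⁅a, b⁆ ≠ 1 := by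
  have : Fact p.Prime := ⟨hp⟩
  have : Finite G := Nat.finite_of_card_ne_zero (by rw [hcard]; exact pow_ne_zero _ hp.ne_zero)
  have hc := hG.commutatorElement_mem_center
  have hnc : ∀ n : G, n ∉ Subgroup.center G → ∃ m : G, ⁅n, m⁆ ≠ 1 := fun n hn => by
    by_contra! h
    exact hn (Subgroup.mem_center_iff.2 fun m =>
      (commutatorElement_eq_one_iff_mul_comm.1 (h m)).symm)
  by_cases hu : u ∈ Subgroup.center G
  · have hu' : ∀ a : G, ⁅u, a⁆ = 1 := fun a =>
      commutatorElement_eq_one_iff_mul_comm.2 (Subgroup.mem_center_iff.1 hu a).symm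
    obtain ⟨q, hq⟩ := @exists_ne _ hG.nontrivial_quotient (1 : G ⧸ Subgroup.center G)
    obtain ⟨n, rfl⟩ := QuotientGroup.mk_surjective q
    obtain ⟨m, hm⟩ := hnc n (fun h => hq ((QuotientGroup.eq_one_iff n).2 h))
    exact ⟨n, m, hu' n, hu' m, hm⟩
  obtain ⟨y, hy⟩ := hnc u hu
  -- The image has order at most `p ^ 2`, so the kernel has order at least `p ^ 3` and contains a
  -- noncentral `n` commuting with both `u` and `y`.
  let φ : G →* Subgroup.center G × Subgroup.center G := MonoidHom.mk'
    (fun t => (⟨⁅u, t⁆, hc u t⟩, ⟨⁅y, t⁆, hc y t⟩)) (fun s t => by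
      ext
      · exact commutatorElement_mul_right_of_central hc u s t
      · exact commutatorElement_mul_right_of_central hc y s t)
  have hker : ∃ n ∈ φ.ker, n ∉ Subgroup.center G := by
    by_contra! h
    have h1 : Nat.card φ.ker ≤ p := by
      rw [← hG.card_center]
      exact Subgroup.card_le_of_le h
    have h2 : Nat.card φ.range ≤ p * p := by
      calc Nat.card φ.range ≤ Nat.card (Subgroup.center G × Subgroup.center G) :=
            Subgroup.card_le_card_group _
        _ = p * p := by rw [Nat.card_prod, hG.card_center]
    have h3 : p ^ 5 = Nat.card φ.range * Nat.card φ.ker := by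
      rw [← hcard, Subgroup.card_eq_card_quotient_mul_card_subgroup φ.ker,
        Nat.card_congr (QuotientGroup.quotientKerEquivRange φ).toEquiv]
    have h4 : p ^ 5 ≤ p ^ 3 := by
      rw [h3, show p ^ 3 = p * p * p by ring]
      exact Nat.mul_le_mul h2 h1
    exact absurd h4 (not_le.2 (Nat.pow_lt_pow_right hp.one_lt (by norm_num)))
  obtain ⟨n, hn, hnZ⟩ := hker
  have hun : ⁅u, n⁆ = 1 := congrArg (fun q => (q.1 : G)) hn
  have hyn : ⁅y, n⁆ = 1 := congrArg (fun q => (q.2 : G)) hn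
  obtain ⟨m, hm⟩ := hnc n hnZ
  -- As `⁅u, y⁆` generates the centre, dividing `m` by a power of `y` makes it commute with `u`;
  -- this leaves `⁅n, m⁆` unchanged because `n` commutes with `y`.
  have hzp : (⟨⁅u, m⁆, hc u m⟩ : Subgroup.center G) ∈
      Subgroup.zpowers (⟨⁅u, y⁆, hc u y⟩ : Subgroup.center G) :=
    mem_zpowers_of_prime_card hG.card_center (fun h => hy (congrArg Subtype.val h))
  obtain ⟨j, hj⟩ := mem_powers_iff_mem_zpowers.2 hzp
  have hj' : ⁅u, y⁆ ^ j = ⁅u, m⁆ := congrArg Subtype.val hj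
  have hny : ⁅n, y⁆ = 1 := by rw [← commutatorElement_inv, hyn, inv_one]
  have hjj : ⁅u, y ^ j⁆ = ⁅u, m⁆ := by rw [commutatorElement_pow_right_of_central hc, hj']
  have hnyj : ⁅n, y ^ j⁆ = 1 := by rw [commutatorElement_pow_right_of_central hc, hny, one_pow]
  have hmul := fun x => commutatorElement_mul_right_of_central hc x (m * (y ^ j)⁻¹) (y ^ j)
  simp only [inv_mul_cancel_right] at hmul
  refine ⟨n, m * (y ^ j)⁻¹, hun, ?_, ?_⟩
  · have := hmul u
    rwa [hjj, right_eq_mul] at this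
  · have := hmul n
    rw [hnyj, mul_one] at this
    rwa [← this]

/-- The noncommuting pair depends on `x`, but its commutator always generates the same group `Z(G)`
of prime order. So a fixed lift `z` of a nontrivial central element is, modulo `Z(K)`, a power of
`⁅a, b⁆` and commutes with every `x`. -/
theorem IsExtraSpecial.not_isCapable {p : ℕ} (hp : p.Prime) {G : Type u} [Group G]
    (hG : IsExtraSpecial p G) (hcard : Nat.card G = p ^ 5) : ¬ IsCapable G := by
  rintro ⟨K, _, ⟨e⟩⟩
  have : Fact p.Prime := ⟨hp⟩
  let π : K →* G := e.symm.toMonoidHom.comp (QuotientGroup.mk' (Subgroup.center K))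
  have hπ : Function.Surjective π := e.symm.surjective.comp (QuotientGroup.mk'_surjective _)
  have hker : ∀ k, π k = 1 ↔ k ∈ Subgroup.center K := fun k => by
    rw [← QuotientGroup.eq_one_iff]
    exact e.symm.map_eq_one_iff
  have hc := hG.commutatorElement_mem_center
  have : Finite (Subgroup.center G) :=
    Nat.finite_of_card_ne_zero (by rw [hG.card_center]; exact hp.ne_zero)
  have : Nontrivial (Subgroup.center G) :=
    Finite.one_lt_card_iff_nontrivial.1 (by rw [hG.card_center]; exact hp.one_lt)
  obtain ⟨⟨g, hgZ⟩, hg⟩ := exists_ne (1 : Subgroup.center G)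
  obtain ⟨z, rfl⟩ := hπ g
  refine hg (Subtype.ext ((hker z).2 (Subgroup.mem_center_iff.2 fun x => ?_)))
  obtain ⟨a, b, ha, hb, hab⟩ := hG.exists_commute_commutatorElement_ne_one hp hcard (π x)
  obtain ⟨a, rfl⟩ := hπ a
  obtain ⟨b, rfl⟩ := hπ b
  have hcomm : Commute x ⁅a, b⁆ := commute_commutatorElement_of_mem_center
    ((hker _).1 (by rw [map_commutatorElement, ha])) ((hker _).1 (by rw [map_commutatorElement, hb]))
  have hzp : (⟨π z, hgZ⟩ : Subgroup.center G) ∈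
      Subgroup.zpowers (⟨⁅π a, π b⁆, hc _ _⟩ : Subgroup.center G) :=
    mem_zpowers_of_prime_card hG.card_center (fun h => hab (congrArg Subtype.val h))
  obtain ⟨j, hj⟩ := hzp
  have hj' : ⁅π a, π b⁆ ^ j = π z := congrArg Subtype.val hj
  have hz : z * (⁅a, b⁆ ^ j)⁻¹ ∈ Subgroup.center K := by
    rw [← hker, map_mul, map_inv, map_zpow, map_commutatorElement, hj', mul_inv_cancel]
  have : Commute x (z * (⁅a, b⁆ ^ j)⁻¹ * ⁅a, b⁆ ^ j) :=
    Commute.mul_right (Subgroup.mem_center_iff.1 hz x) (hcomm.zpow_right j)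
  rwa [inv_mul_cancel_right] at this

/-! ### Proof of the trichotomy -/

namespace BaerModule

variable {p : ℕ} {G L : Type*} [Group G] [AddCommGroup L] [Module (ZMod p) L]
  (M : BaerModule p G L)

theorem natCard_center_eq (h : ∀ v, M.bracket v = 0 → v ∈ M.derived) :
    Nat.card (Subgroup.center G) = Nat.card M.derived :=
  Nat.card_congr (M.toEquiv.subtypeEquiv fun g => (M.mem_center_iff g).trans
    ⟨h _, M.bracket_eq_zero_of_mem_derived⟩)

end BaerModule

theorem isCapable_of_not_isCyclic_of_not_isExtraSpecial (p : ℕ) (hp : p.Prime) (hodd : Odd p)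
    (G : Type u) [Group G] (hgen : IsGeneratedBy 4 G)
    (hc : ∀ x y : G, ⁅x, y⁆ ∈ Subgroup.center G) (hexp : ∀ g : G, g ^ p = 1)
    (hcyc : ¬ (IsCyclic G ∧ Nontrivial G))
    (hes : ¬ (IsExtraSpecial p G ∧ Nat.card G = p ^ 5 ∧ Monoid.exponent G = p)) :
    IsCapable G := by
  have : Fact p.Prime := ⟨hp⟩
  obtain ⟨L, _, _, ⟨M⟩⟩ := exists_baerModule p hodd G hc hexp
  refine isCapable_of_cocycles (ZMod p) G fun g hg hg1 => ?_
  -- The trivial group is cyclic, but it has no `g ≠ 1` to detect; the given `g` supplies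
  -- nontriviality.
  have hcyc' : ¬ IsCyclic G := fun h => hcyc ⟨h, nontrivial_of_ne g 1 hg1⟩
  suffices M.Detected (M.toEquiv g) by simpa [BaerModule.Detected] using this
  have hz := (M.mem_center_iff g).1 hg
  by_cases hD : M.toEquiv g ∉ M.derived
  · exact M.detected_of_notMem_derived hcyc' hz hD
  rw [not_not] at hD
  have hg0 : M.toEquiv g ≠ 0 := fun h => hg1 (M.toEquiv.injective (h.trans M.toEquiv_one.symm))
  obtain ⟨s, hs⟩ := hgen
  have hspan := M.span_quotient_eq_top s hs
  have : Module.Finite (ZMod p) (L ⧸ M.derived) :=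
    ⟨⟨(Set.finite_range _).toFinset, by rw [Set.Finite.coe_toFinset]; exact hspan⟩⟩
  have hfin : Module.finrank (ZMod p) (L ⧸ M.derived) ≤ 4 := by
    have := finrank_range_le_card (R := ZMod p) fun i => M.derived.mkQ (M.toEquiv (s i))
    rwa [Set.finrank, hspan, finrank_top, Fintype.card_fin] at this
  -- In the symplectic case `L` has dimension `4 + 1` and the centre of `G` corresponds to the
  -- derived line, so `G` is the excluded extra-special group.
  rcases M.detected_or_symplectic hfin hg0 hz hD with h | ⟨h4, hDz, hcenter⟩
  · exact h
  exfalso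
  have : Module.Finite (ZMod p) M.derived := by rw [hDz]; infer_instance
  have hcardD : Nat.card M.derived = p := by
    rw [Module.natCard_eq_pow_finrank (K := ZMod p), hDz, finrank_span_singleton hg0,
      Nat.card_zmod, pow_one]
  have hcard : Nat.card G = p ^ 5 := by
    have h := AddSubgroup.card_eq_card_quotient_mul_card_addSubgroup M.derived.toAddSubgroup
    have hQ : Nat.card (L ⧸ M.derived) = p ^ 4 := by
      rw [Module.natCard_eq_pow_finrank (K := ZMod p), h4, Nat.card_zmod]
    rw [Nat.card_congr M.toEquiv, h]
    change Nat.card (L ⧸ M.derived) * Nat.card M.derived = _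
    rw [hQ, hcardD, ← pow_succ]
  have hcardZ : Nat.card (Subgroup.center G) = p := by rw [M.natCard_center_eq hcenter, hcardD]
  have hquot : Nontrivial (G ⧸ Subgroup.center G) := by
    rw [QuotientGroup.nontrivial_iff]
    intro h
    rw [h, Subgroup.card_top, hcard] at hcardZ
    have := (Nat.pow_right_injective hp.two_le) (hcardZ.trans (pow_one p).symm)
    omega
  refine hes ⟨⟨⟨5, hcard⟩, hcardZ, hquot, ?_, ?_⟩, hcard, ?_⟩
  · intro a b
    obtain ⟨a, rfl⟩ := QuotientGroup.mk'_surjective _ a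
    obtain ⟨b, rfl⟩ := QuotientGroup.mk'_surjective _ b
    rw [← commutatorElement_eq_one_iff_mul_comm, ← map_commutatorElement, QuotientGroup.mk'_apply,
      QuotientGroup.eq_one_iff]
    exact hc a b
  · intro a
    obtain ⟨a, rfl⟩ := QuotientGroup.mk'_surjective _ a
    rw [← map_pow, hexp, map_one]
  · rcases (Nat.dvd_prime hp).1 (Monoid.exponent_dvd_of_forall_pow_eq_one hexp) with h | h
    · exact absurd (by simpa [h] using Monoid.pow_exponent_eq_one g) hg1
    · exact h

theorem mainTheorem1 (p : ℕ) (hp : p.Prime) (hodd : Odd p) (G : Type u) [Group G]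
    (hgen : IsGeneratedBy 4 G)
    (hnil : Group.IsNilpotent G) (hclass : Group.nilpotencyClass G ≤ 2)
    (hexp : ∀ g : G, g ^ p = 1) :
    ExactlyOne
      (IsCyclic G ∧ Nontrivial G)
      (IsExtraSpecial p G ∧ Nat.card G = p ^ 5 ∧ Monoid.exponent G = p)
      (IsCapable G) := by
  have hc : ∀ x y : G, ⁅x, y⁆ ∈ Subgroup.center G := by
    intro x y
    have h : x ∈ Subgroup.upperCentralSeries G 2 := by
      rw [Subgroup.upperCentralSeries_eq_top_iff_nilpotencyClass_le.2 hclass]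
      exact Subgroup.mem_top x
    have h1 := (Subgroup.mem_upperCentralSeries_succ_iff).1 h y
    rwa [Subgroup.upperCentralSeries_one] at h1
  by_cases h1 : IsCyclic G ∧ Nontrivial G
  · obtain ⟨_, _⟩ := h1
    refine Or.inl ⟨⟨inferInstance, inferInstance⟩, ?_, not_isCapable_of_isCyclic G⟩
    rintro ⟨hes, -, -⟩
    have hab : ∀ a b : G, a * b = b * a := fun a b => by
      obtain ⟨g, hg⟩ := IsCyclic.exists_generator (α := G)
      obtain ⟨m, rfl⟩ := hg a
      obtain ⟨n, rfl⟩ := hg b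
      exact (Commute.refl g).zpow_zpow m n
    refine not_subsingleton_iff_nontrivial.2 hes.nontrivial_quotient ?_
    rw [QuotientGroup.subsingleton_iff, eq_top_iff]
    exact fun x _ => Subgroup.mem_center_iff.2 fun y => hab y x
  · by_cases h2 : IsExtraSpecial p G ∧ Nat.card G = p ^ 5 ∧ Monoid.exponent G = p
    · exact Or.inr (Or.inl ⟨h1, h2, h2.1.not_isCapable hp h2.2.1⟩)
    · exact Or.inr (Or.inr ⟨h1, h2,
        isCapable_of_not_isCyclic_of_not_isExtraSpecial p hp hodd G hgen hc hexp h1 h2⟩)
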